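/- \textbf{Setting.} Let $S^1=[-1,1]/(-1\sim 1)$, $T^2=S^1\times S^1$, and let $m$ be Lebesgue measure. \emph{Cantor sets.} Let $c\in\mathbb R$, $0<b<r$ and $\alpha_n>0$ ($n\ge1$) satisfy $\sum_{n\ge1}\alpha_n<2(r-b)$, $\alpha_{n+1}<\alpha_n$, $\alpha_{n+1}/\alpha_n\to1$, $\alpha_1<2b$. Start with the atom $[c-r,c+r]$ of generation $0$ (empty word). From each atom $I_w$ of generation $n$, $w\in\{0,1\}^n$, remove the open gap $I_w^*$ centred at its midpoint, of length $2b$ if $n=0$ and $\alpha_n/2^n$ if $n\ge1$; the closed intervals left are the atoms $I_{w0}$ (on the left) and $I_{w1}$ (on the right) of generation $n+1$. The Cantor set is $K=\bigcap_{n\ge1}\bigcup_{w\in\{0,1\}^n}I_w$. A \emph{Bowen map} for it is a map $G$ that is continuous on $I_0\cup I_1$ and maps each gap $I^*_{a_0a_1\dots a_n}$ onto $I^*_{a_1\dots a_n}$ as an increasing $C^1$ map with $G'>1$ and $G'\to2$ at both ends of the gap, such that, for some $\epsilon_n\to0$, $|G'-2|<\epsilon_n$ on all gaps of generation $n+1$,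 $n\ge1$. \emph{Circle maps.} For $k\ge1$, let $\mathcal B_k$ be the class of maps $g:S^1\to S^1$ that have a $C^1$ lift to $\mathbb R$ with derivative bounded below by some $\lambda>1$, together with $k$ Cantor sets $K_1,\dots,K_k\subset[-1,1]$ as above and Bowen maps $G_1,\dots,G_k$ for them, such that: $K_1$ is constructed in $[-1,1]$; for $i\ge2$ the interval $[c_i-r_i,c_i+r_i]$ in which $K_i$ is constructed is contained in a gap (of any generation, the host gap of $i$) of some $K_j$ with $j<i$; host gaps of different $i$ are different; and $g=G_i$ modulo $2\mathbb{Z}$ at every point of the two generation-one atoms of $K_i$ that lies in none of the gaps of $K_i$ chosen as host gaps. On a Cantor set $K\subset S^1$ put $\mu_K(B)=m(B\cap K)/m(K)$. Let $f_1\in\mathcal B_1$ with Cantor set $K_{S^1}$ and Bowen map $G$, let $f_2\in\mathcal B_k$ with Cantor sets $K_{1,S^1},\dots,K_{k,S^1}$ and Bowen maps $G_1,\dots,G_k$, and let $f(x,y)=(f_1(x),f_2(y))$ on $T^2$. For $1\le i\le k$ put $K_{i,T^2}=K_{S^1}\times K_{i,S^1}$ and $\mu_{K_{i,T^2}}=\mu_{K_{S^1}}\times\mu_{K_{i,S^1}}$.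 Let $\sigma(c_0c_1\dots)=c_1c_2\dots$ on $\{0,1,2,3\}^{\mathbb N}$ and let $\nu$ be the Bernoulli measure with weight $1/4$ for each symbol. An itinerary of $x\in K_{S^1}$ is a sequence $(a_n)$ in $\{0,1\}$ such that $f_1^n(x)$ lies in the generation-one atom $I_{a_n}$ of $K_{S^1}$ for all $n\geq 0$; likewise $(b_n)$ for $y\in K_{i,S^1}$ and $f_2$. The combined itinerary is $h(x,y)=(2a_n+b_n)_{n\ge0}$. The only ambiguity arises when an orbit hits the point $-1\sim1$, which is common to two atoms if the Cantor set is constructed in $[-1,1]$; on the circle it then gets the symbol $1$. \textbf{Proposition.} For every $i\in\{1,\dots,k\}$: (1) $\mu_{K_{i,T^2}}$ is an $f$-invariant Borel probability measure with $\mu_{K_{i,T^2}}(K_{i,T^2})=1$. (2) (Before identifying $-1$ with $1$.) Regard $K_{S^1}$ and $K_{i,S^1}$ as subsets of $[-1,1]$. The map $G\times G_i$ maps $K_{S^1}\times K_{i,S^1}$ into itself and induces $f$ there. The combined itinerary map $h$, defined with $G,G_i$ instead of $f_1,f_2$, is a bijection from $K_{S^1}\times K_{i,S^1}$ onto $\{0,1,2,3\}^{\mathbb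 N}$, measurable with measurable inverse, $h\circ(G\times G_i)=\sigma\circ h$, and $h$ carries the product of the normalized Lebesgue measures on the two Cantor sets to $\nu$. (3) (On the torus.) $h$ is measurable, gives itineraries at all points of $K_{i,T^2}$, satisfies $h\circ f=\sigma\circ h$ on $K_{i,T^2}$, and $h_*\mu_{K_{i,T^2}}=\nu$. Let $E$ be the set of points of $K_{i,T^2}$ none of whose iterates under $f$ has a coordinate equal to the point $-1\sim1$. Then $E$ is a Borel set, $f(E)\subset E$, $\mu_{K_{i,T^2}}(E)=1$, $h$ is injective on $E$, the image under $h$ of every Borel subset of $E$ is Borel, and $\nu(h(E))=1$. So $(f,\mu_{K_{i,T^2}})$ is conjugate, through the combined itinerary map, to the Bernoulli shift $(\sigma,\nu)$. -/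

import Mathlib

open Set Filter Topology MeasureTheory ProbabilityTheory

noncomputable section

namespace BowenTorus

/-- Needed for the Lebesgue measure on `AddCircle 2`. -/
instance factTwoPos : Fact ((0 : ℝ) < 2) := ⟨two_pos⟩

/-- The circle `[-1, 1] / (-1 ∼ 1)`; its `volume` is Lebesgue measure, of total mass `2`. -/
abbrev Circ : Type := AddCircle (2 : ℝ)

/-- The one-sided shift `(a₀ a₁ a₂ …) ↦ (a₁ a₂ …)`. -/
def shift {S : Type*} (a : ℕ → S) : ℕ → S := fun n => a (n + 1)

/-- The parameters of Bowen's construction of a Cantor set in the interval `[c - r, c + r]` with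
central gap `(c - b, c + b)`. Only `α n` with `1 ≤ n` is used: the gaps of generation `n` have total
length `α n`. -/
structure CantorData where
  c : ℝ
  r : ℝ
  b : ℝ
  α : ℕ → ℝ
  b_pos : 0 < b
  b_lt : b < r
  α_pos : ∀ n, 1 ≤ n → 0 < α n
  α_summable : Summable fun n => α (n + 1)
  α_sum : ∑' n, α (n + 1) < 2 * (r - b)
  α_anti : ∀ n, 1 ≤ n → α (n + 1) < α n
  α_ratio : Tendsto (fun n => α (n + 1) / α n) atTop (𝓝 1)
  α_one : α 1 < 2 * b

namespace CantorData

variable (P : CantorData)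

/-- The length of each of the `2 ^ n` gaps of generation `n`. -/
def gapLen : ℕ → ℝ
  | 0 => 2 * P.b
  | n + 1 => P.α (n + 1) / 2 ^ (n + 1)

/-- The pair (left end, right end) of the atom of generation `n` with word `a 0, …, a (n - 1)`
(the other entries of `a` play no role): remove the centred open gap from the previous atom, and
keep its left part for the symbol `0`, its right part for the symbol `1`. -/
def ends (a : ℕ → Fin 2) : ℕ → ℝ × ℝ
  | 0 => (P.c - P.r, P.c + P.r)
  | n + 1 =>
    if a n = 0 then
      ((ends a n).1, ((ends a n).1 + (ends a n).2) / 2 - P.gapLen n / 2)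
    else
      (((ends a n).1 + (ends a n).2) / 2 + P.gapLen n / 2, (ends a n).2)

/-- The atom of generation `n` with word `a 0, …, a (n - 1)`. -/
def atom (a : ℕ → Fin 2) (n : ℕ) : Set ℝ := Icc (P.ends a n).1 (P.ends a n).2

/-- Left end of the gap of generation `n` inside the atom with word `a 0, …, a (n - 1)`. -/
def gapLeft (a : ℕ → Fin 2) (n : ℕ) : ℝ :=
  ((P.ends a n).1 + (P.ends a n).2) / 2 - P.gapLen n / 2

/-- Right end of the gap of generation `n` inside the atom with word `a 0, …, a (n - 1)`. -/
def gapRight (a : ℕ → Fin 2) (n : ℕ) : ℝ :=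
  ((P.ends a n).1 + (P.ends a n).2) / 2 + P.gapLen n / 2

/-- The gap of generation `n` inside the atom with word `a 0, …, a (n - 1)`. -/
def gap (a : ℕ → Fin 2) (n : ℕ) : Set ℝ := Ioo (P.gapLeft a n) (P.gapRight a n)

/-- The two atoms of generation `1`, `I₀ = [c - r, c - b]` and `I₁ = [c + b, c + r]`. -/
def piece (e : Fin 2) : Set ℝ :=
  if e = 0 then Icc (P.c - P.r) (P.c - P.b) else Icc (P.c + P.b) (P.c + P.r)

/-- The Cantor set: the points that lie in some atom of each generation `n ≥ 1`. -/
def cantor : Set ℝ := ⋂ n : ℕ, ⋃ a : ℕ → Fin 2, P.atom a (n + 1)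

/-- The same Cantor set on the circle. -/
def cantorCirc : Set Circ := (fun x : ℝ => (x : Circ)) '' P.cantor

end CantorData

/-- `G` is a map obtained by Bowen's construction on `I₀ ∪ I₁`: it sends each gap of generation
`n + 1` onto the gap of generation `n` whose word is the shifted one, as an increasing expanding
`C¹` map with derivative tending to `2` at the ends of the gap and uniformly close to `2` on
gaps of high generation, and it extends continuously to `I₀ ∪ I₁`. -/
structure IsBowenMap (P : CantorData) (G : ℝ → ℝ) : Prop where
  cont : ContinuousOn G (P.piece 0 ∪ P.piece 1)
  smooth : ∀ a n, ContDiffOn ℝ 1 G (P.gap a (n + 1))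
  mono : ∀ a n, StrictMonoOn G (P.gap a (n + 1))
  surj : ∀ a n, G '' P.gap a (n + 1) = P.gap (shift a) n
  expanding : ∀ a n, ∀ x ∈ P.gap a (n + 1), 1 < deriv G x
  deriv_left : ∀ a n, Tendsto (deriv G) (𝓝[>] (P.gapLeft a (n + 1))) (𝓝 2)
  deriv_right : ∀ a n, Tendsto (deriv G) (𝓝[<] (P.gapRight a (n + 1))) (𝓝 2)
  deriv_near : ∃ ε : ℕ → ℝ, Tendsto ε atTop (𝓝 0) ∧
    ∀ n, 1 ≤ n → ∀ a, ∀ x ∈ P.gap a (n + 1), |deriv G x - 2| < ε n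

/-- An orientation-preserving expanding `C¹` map of the circle carrying `k` Cantor sets of Bowen
type. The set number `0` is constructed in the whole interval `[-1, 1]`. Each other one is
constructed in an interval `[c - r, c + r]` inside a gap (its host gap) of a set with smaller
number, distinct sets having distinct host gaps. Outside the host gaps contained in them, on the
two atoms of generation `1` of the `i`-th set the map is the `i`-th Bowen map. -/
structure BowenCircleMap (k : ℕ) [NeZero k] where
  /-- the circle map -/
  f : Circ → Circ
  /-- a lift of `f` to the line -/
  F : ℝ → ℝ
  lift : ∀ x : ℝ, f (x : Circ) = (F x : Circ)
  smooth : ContDiff ℝ 1 F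
  expanding : ∃ l : ℝ, 1 < l ∧ ∀ x, l ≤ deriv F x
  /-- the `k` Cantor constructions -/
  P : Fin k → CantorData
  /-- the `k` Bowen maps -/
  G : Fin k → ℝ → ℝ
  bowen : ∀ i, IsBowenMap (P i) (G i)
  center_zero : (P 0).c = 0
  radius_zero : (P 0).r = 1
  /-- the host gap of the `i`-th set, for `i ≠ 0`, is the gap of the set number `host i`, of
  generation `hostGen i`, with word `hostWord i` -/
  host : Fin k → Fin k
  hostGen : Fin k → ℕ
  hostWord : Fin k → ℕ → Fin 2
  host_lt : ∀ i, i ≠ 0 → host i < i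
  sub_host : ∀ i, i ≠ 0 → Icc ((P i).c - (P i).r) ((P i).c + (P i).r) ⊆
    (P (host i)).gap (hostWord i) (hostGen i)
  host_ne : ∀ i j, i ≠ 0 → j ≠ 0 → i ≠ j →
    (P (host i)).gap (hostWord i) (hostGen i) ≠ (P (host j)).gap (hostWord j) (hostGen j)
  agree : ∀ i, ∀ x ∈ (P i).piece 0 ∪ (P i).piece 1,
    (∀ j, j ≠ 0 → host j = i → x ∉ (P i).gap (hostWord j) (hostGen j)) →
      f (x : Circ) = (G i x : Circ)

/-- The `i`-th Cantor set of the map, on the circle. -/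
def BowenCircleMap.K {k : ℕ} [NeZero k] (Φ : BowenCircleMap k) (i : Fin k) : Set Circ :=
  (Φ.P i).cantorCirc

/-- Normalized Lebesgue measure `B ↦ m (B ∩ K) / m K` on the `i`-th Cantor set in the circle. -/
def BowenCircleMap.μ {k : ℕ} [NeZero k] (Φ : BowenCircleMap k) (i : Fin k) : Measure Circ :=
  ProbabilityTheory.cond volume (Φ.K i)

/-- The `i`-th atom of generation `1` with symbol `e`, on the circle. -/
def BowenCircleMap.pieceCirc {k : ℕ} [NeZero k] (Φ : BowenCircleMap k) (i : Fin k) (e : Fin 2) :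
    Set Circ := (fun x : ℝ => (x : Circ)) '' (Φ.P i).piece e

open Classical in
/-- The itinerary of `x`: the symbol at time `n` is `1` if `g^n x ∈ A`, and `0` otherwise. -/
def itin {X : Type*} (g : X → X) (A : Set X) (x : X) : ℕ → Fin 2 :=
  fun n => if g^[n] x ∈ A then 1 else 0

/-- The symbol of the four-letter alphabet that codes a pair of binary symbols:
`00 ↦ 0`, `01 ↦ 1`, `10 ↦ 2`, `11 ↦ 3`. -/
def pairSymbol (a b : Fin 2) : Fin 4 := ⟨2 * a.val + b.val, by omega⟩

/-- The combination of two binary sequences into a four-letter sequence. -/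
def pairSeq (a b : ℕ → Fin 2) : ℕ → Fin 4 := fun n => pairSymbol (a n) (b n)

/-- The Bernoulli measure on `{0,1,2,3}^ℕ` giving weight `1/4` to each symbol. -/
def bernoulliFour : Measure (ℕ → Fin 4) :=
  Measure.infinitePi fun _ : ℕ => (PMF.uniformOfFintype (Fin 4)).toMeasure

/-- The product map of the torus. -/
def torusMap (f₁ f₂ : Circ → Circ) : Circ × Circ → Circ × Circ := fun p => (f₁ p.1, f₂ p.2)

end BowenTorus

end

/-! All atoms of one generation have the same length, so the left end of an atom is `c - r` plus the
sum of `a j * step j` over its word. Hence the Cantor set is the image of the injective continuous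
map `code` on binary sequences (`range_code`, `code_injective`). A Bowen map shifts the words of
gaps, and the gaps along a word shrink to the coded point, so continuity turns the map into the
shift on the Cantor set (`IsBowenMap.map_code`). Host gaps miss the Cantor set, so the circle map
acts there in the same way. The parts of the Cantor set inside atoms of one generation are
translates of each other (`volume_image_cylinder`), and the set has positive measure. Its normalized
Lebesgue measure is therefore the image of the measure on sequences that gives equal mass to
cylinders of equal length, the Bernoulli measure. Passing to the circle only glues `-1` to `1`;
almost every orbit avoids this point. Interleaving two binary sequences by `pairEquiv` gives the
torus statement. -/

noncomputable section

namespace BowenTorus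

/-! ### Coding the points of a Cantor set by binary sequences. -/

namespace CantorData

variable (P : CantorData)

/-- The common length of the atoms of generation `n`. -/
def len : ℕ → ℝ
  | 0 => 2 * P.r
  | n + 1 => (len n - P.gapLen n) / 2

/-- The distance between the left ends of the two atoms of generation `n + 1` inside a common atom
of generation `n`. -/
def step (n : ℕ) : ℝ := P.len n - P.len (n + 1)

/-- The point of the Cantor set with a given itinerary. -/
def code (a : ℕ → Fin 2) : ℝ := P.c - P.r + ∑' n, (a n : ℝ) * P.step n

lemma gapLen_pos (n : ℕ) : 0 < P.gapLen n := by
  cases n with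
  | zero => exact mul_pos two_pos P.b_pos
  | succ n => exact div_pos (P.α_pos _ (by omega)) (by positivity)

/-- Total length of one generation of atoms. Together with `α_sum` it keeps the atoms nondegenerate
in `len_pos`. -/
lemma two_pow_mul_len (n : ℕ) :
    2 ^ (n + 1) * P.len (n + 1) = 2 * (P.r - P.b) - ∑ j ∈ Finset.range n, P.α (j + 1) := by
  induction n with
  | zero => simp [len, gapLen]; ring
  | succ n ih =>
    rw [Finset.sum_range_succ, len, gapLen, ← sub_sub, ← ih]
    field_simp
    ring

lemma r_pos : 0 < P.r := P.b_pos.trans P.b_lt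

lemma len_pos (n : ℕ) : 0 < P.len n := by
  cases n with
  | zero => exact mul_pos two_pos P.r_pos
  | succ n =>
    have h := P.two_pow_mul_len n
    have h1 : ∑ j ∈ Finset.range n, P.α (j + 1) ≤ ∑' j, P.α (j + 1) :=
      P.α_summable.sum_le_tsum _ fun j _ => (P.α_pos _ (by omega)).le
    have h2 := P.α_sum
    exact pos_of_mul_pos_right (a := (2 : ℝ) ^ (n + 1)) (by linarith) (by positivity)

lemma step_eq (n : ℕ) : P.step n = P.len (n + 1) + P.gapLen n := by
  simp only [step, len]; ring

lemma step_pos (n : ℕ) : 0 < P.step n := by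
  rw [step_eq]; linarith [P.len_pos (n + 1), P.gapLen_pos n]

lemma len_le (n : ℕ) : P.len n ≤ 2 * P.r * (1 / 2) ^ n := by
  induction n with
  | zero => simp [len]
  | succ n ih =>
    rw [pow_succ, len]
    linarith [P.gapLen_pos n]

lemma tendsto_len : Tendsto P.len atTop (𝓝 0) := by
  have h : Tendsto (fun n : ℕ => 2 * P.r * (1 / 2 : ℝ) ^ n) atTop (𝓝 (2 * P.r * 0)) :=
    (tendsto_pow_atTop_nhds_zero_of_lt_one (by norm_num) (by norm_num)).const_mul _
  rw [mul_zero] at h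
  exact squeeze_zero (fun n => (P.len_pos n).le) P.len_le h

/-- The sum telescopes and `len` tends to `0`. The tail of a code thus ranges between `0` and the
length of the atom of generation `n`. -/
lemma hasSum_step (n : ℕ) : HasSum (fun j => P.step (j + n)) (P.len n) := by
  rw [hasSum_iff_tendsto_nat_of_nonneg fun j => (P.step_pos _).le]
  have h : ∀ m, ∑ j ∈ Finset.range m, P.step (j + n) = P.len n - P.len (m + n) := by
    intro m
    induction m with
    | zero => simp
    | succ m ih => rw [Finset.sum_range_succ, ih, step, add_right_comm]; ring
  simp only [h]
  simpa using ((tendsto_add_atTop_iff_nat n).2 P.tendsto_len).const_sub (P.len n)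

lemma fin_two_cast_le (e : Fin 2) : (e : ℝ) ≤ 1 := by
  have := e.is_le
  exact_mod_cast this

lemma summable_code (a : ℕ → Fin 2) (n : ℕ) :
    Summable fun j => (a (j + n) : ℝ) * P.step (j + n) :=
  .of_nonneg_of_le (fun _ => mul_nonneg (Nat.cast_nonneg _) (P.step_pos _).le)
    (fun _ => mul_le_of_le_one_left (P.step_pos _).le (fin_two_cast_le _))
    (P.hasSum_step n).summable

lemma ends_snd (a : ℕ → Fin 2) (n : ℕ) : (P.ends a n).2 = (P.ends a n).1 + P.len n := by
  induction n with
  | zero => simp [ends, len]; ring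
  | succ n ih => rw [ends, len]; split_ifs <;> simp only [ih] <;> ring

lemma ends_fst_succ (a : ℕ → Fin 2) (n : ℕ) :
    (P.ends a (n + 1)).1 = (P.ends a n).1 + a n * P.step n := by
  rw [ends]
  split_ifs with h
  · simp [h]
  · have : a n = 1 := by omega
    simp only [this, ends_snd, step, len]
    simp; ring

lemma ends_fst (a : ℕ → Fin 2) (n : ℕ) :
    (P.ends a n).1 = P.c - P.r + ∑ j ∈ Finset.range n, (a j : ℝ) * P.step j := by
  induction n with
  | zero => simp [ends]
  | succ n ih => rw [ends_fst_succ, ih, Finset.sum_range_succ, add_assoc]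

lemma code_eq (a : ℕ → Fin 2) (n : ℕ) :
    P.code a = (P.ends a n).1 + ∑' j, (a (j + n) : ℝ) * P.step (j + n) := by
  have h : Summable fun j => (a j : ℝ) * P.step j := P.summable_code a 0
  rw [code, ends_fst, ← h.sum_add_tsum_nat_add n, add_assoc]

lemma ends_congr {a a' : ℕ → Fin 2} {n : ℕ} (h : ∀ j < n, a j = a' j) :
    P.ends a n = P.ends a' n := by
  have h1 : (P.ends a n).1 = (P.ends a' n).1 := by
    rw [ends_fst, ends_fst]
    congr 1
    exact Finset.sum_congr rfl fun j hj => by rw [h j (Finset.mem_range.1 hj)]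
  exact Prod.ext h1 (by rw [ends_snd, ends_snd, h1])

lemma code_mem_atom (a : ℕ → Fin 2) (n : ℕ) : P.code a ∈ P.atom a n := by
  rw [atom, mem_Icc, ends_snd, P.code_eq a n]
  constructor
  · exact le_add_of_nonneg_right
      (tsum_nonneg fun j => mul_nonneg (Nat.cast_nonneg _) (P.step_pos _).le)
  · gcongr
    rw [← (P.hasSum_step n).tsum_eq]
    exact (P.summable_code a n).tsum_le_tsum
      (fun _ => mul_le_of_le_one_left (P.step_pos _).le (fin_two_cast_le _))
      (P.hasSum_step n).summable

lemma atom_succ_subset (a : ℕ → Fin 2) (n : ℕ) : P.atom a (n + 1) ⊆ P.atom a n := by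
  have h0 := P.step_pos n
  have h1 : 0 ≤ (a n : ℝ) := Nat.cast_nonneg _
  have h2 := fin_two_cast_le (a n)
  refine Icc_subset_Icc ?_ ?_
  · rw [ends_fst_succ]; nlinarith
  · rw [ends_snd, ends_snd, ends_fst_succ]
    have : P.len (n + 1) = P.len n - P.step n := by rw [step]; ring
    nlinarith

lemma atom_anti (a : ℕ → Fin 2) {m n : ℕ} (h : m ≤ n) : P.atom a n ⊆ P.atom a m :=
  antitone_nat_of_succ_le (f := P.atom a) (P.atom_succ_subset a) h

lemma gapLeft_eq (a : ℕ → Fin 2) (n : ℕ) : P.gapLeft a n = (P.ends a n).1 + P.len (n + 1) := by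
  rw [gapLeft, ends_snd, len]; ring

lemma gapRight_eq (a : ℕ → Fin 2) (n : ℕ) : P.gapRight a n = (P.ends a n).1 + P.step n := by
  rw [gapRight, ends_snd, step, len]; ring

lemma gap_subset_atom (a : ℕ → Fin 2) (n : ℕ) : P.gap a n ⊆ P.atom a n := by
  intro x hx
  rw [gap, mem_Ioo, gapLeft_eq, gapRight_eq, step] at hx
  rw [atom, mem_Icc, ends_snd]
  constructor <;> linarith [P.len_pos (n + 1)]

lemma atom_succ_of_eq_zero {a : ℕ → Fin 2} {n : ℕ} (h : a n = 0) :
    P.atom a (n + 1) = Icc (P.ends a n).1 (P.gapLeft a n) := by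
  simp [atom, ends, h, gapLeft]

lemma atom_succ_of_ne_zero {a : ℕ → Fin 2} {n : ℕ} (h : a n ≠ 0) :
    P.atom a (n + 1) = Icc (P.gapRight a n) (P.ends a n).2 := by
  simp [atom, ends, h, gapRight]

lemma gapLeft_lt_gapRight (a : ℕ → Fin 2) (n : ℕ) : P.gapLeft a n < P.gapRight a n := by
  rw [gapLeft_eq, gapRight_eq, step_eq]; linarith [P.gapLen_pos n]

lemma gapLeft_congr {a a' : ℕ → Fin 2} {n : ℕ} (h : ∀ j < n, a j = a' j) :
    P.gapLeft a n = P.gapLeft a' n := by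
  rw [gapLeft, gapLeft, P.ends_congr h]

lemma gapRight_congr {a a' : ℕ → Fin 2} {n : ℕ} (h : ∀ j < n, a j = a' j) :
    P.gapRight a n = P.gapRight a' n := by
  rw [gapRight, gapRight, P.ends_congr h]

/-- Induction on the generation: once the first `n` symbols agree, different symbols at place `n`
put the two atoms on opposite sides of a nonempty gap. -/
lemma code_mem_atom_iff {a a' : ℕ → Fin 2} {n : ℕ} :
    P.code a ∈ P.atom a' n ↔ ∀ j < n, a j = a' j := by
  refine ⟨fun h => ?_, fun h => ?_⟩
  · induction n with
    | zero => simp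
    | succ n ih =>
      have hn := ih (P.atom_succ_subset a' n h)
      have h1 := P.code_mem_atom a (n + 1)
      have hlt := P.gapLeft_lt_gapRight a n
      have hl := P.gapLeft_congr hn
      have hr := P.gapRight_congr hn
      have key : a n = a' n := by
        by_cases h0 : a n = 0 <;> by_cases h0' : a' n = 0
        · rw [h0, h0']
        · rw [P.atom_succ_of_eq_zero h0] at h1
          rw [P.atom_succ_of_ne_zero h0'] at h
          linarith [h1.2, h.1]
        · rw [P.atom_succ_of_ne_zero h0] at h1
          rw [P.atom_succ_of_eq_zero h0'] at h
          linarith [h1.1, h.2]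
        · omega
      intro j hj
      rcases Nat.lt_succ_iff_lt_or_eq.1 hj with hj | rfl
      exacts [hn j hj, key]
  · have := P.code_mem_atom a n
    rwa [atom, P.ends_congr h] at this

lemma code_injective : Function.Injective P.code := fun _ a' h => funext fun n =>
  P.code_mem_atom_iff.1 (h ▸ P.code_mem_atom a' (n + 1)) n n.lt_succ_self

lemma continuous_code : Continuous P.code := by
  refine continuous_const.add (continuous_tsum (u := P.step) (fun n => ?_)
    (P.hasSum_step 0).summable fun n _ => ?_)
  · exact (continuous_of_discreteTopology (f := fun e : Fin 2 => ((e : ℕ) : ℝ))).comp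
      (continuous_apply n) |>.mul continuous_const
  · rw [Real.norm_of_nonneg (mul_nonneg (Nat.cast_nonneg _) (P.step_pos _).le)]
    exact mul_le_of_le_one_left (P.step_pos _).le (fin_two_cast_le _)

lemma dist_code_le {a : ℕ → Fin 2} {n : ℕ} {x : ℝ} (h : x ∈ P.atom a n) :
    dist x (P.code a) ≤ P.len n := by
  have := Real.dist_le_of_mem_Icc h (P.code_mem_atom a n)
  rwa [ends_snd, add_sub_cancel_left] at this

/-- A point of the Cantor set is within `len (n + 1)` of some code for every `n`, and the set of
codes is compact, hence closed; the words at different `n` need not be compatible. -/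
lemma range_code : range P.code = P.cantor := by
  refine Subset.antisymm ?_ fun x hx => ?_
  · rintro _ ⟨a, rfl⟩
    exact mem_iInter.2 fun n => mem_iUnion.2 ⟨a, P.code_mem_atom a _⟩
  · rw [← (isCompact_range P.continuous_code).isClosed.closure_eq, Metric.mem_closure_iff]
    intro ε hε
    obtain ⟨n, hn⟩ := (((tendsto_add_atTop_iff_nat 1).2 P.tendsto_len).eventually
      (gt_mem_nhds hε)).exists
    obtain ⟨a, ha⟩ := mem_iUnion.1 (mem_iInter.1 hx n)
    exact ⟨_, mem_range_self a, (P.dist_code_le ha).trans_lt hn⟩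

lemma isClosed_cantor : IsClosed P.cantor :=
  P.range_code ▸ (isCompact_range P.continuous_code).isClosed

lemma isClosedEmbedding_code : IsClosedEmbedding P.code :=
  P.continuous_code.isClosedEmbedding P.code_injective

lemma code_notMem_gap (a a' : ℕ → Fin 2) (n : ℕ) : P.code a ∉ P.gap a' n := by
  intro h
  have hj := P.code_mem_atom_iff.1 (P.gap_subset_atom a' n h)
  rw [gap, ← P.gapLeft_congr hj, ← P.gapRight_congr hj] at h
  have h1 := P.code_mem_atom a (n + 1)
  by_cases h0 : a n = 0
  · rw [P.atom_succ_of_eq_zero h0] at h1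
    linarith [h1.2, h.1]
  · rw [P.atom_succ_of_ne_zero h0] at h1
    linarith [h1.1, h.2]

lemma atom_one (a : ℕ → Fin 2) : P.atom a 1 = P.piece (a 0) := by
  by_cases h : a 0 = 0
  · rw [P.atom_succ_of_eq_zero h, piece, if_pos h, gapLeft_eq]
    congr 1
    simp [ends, len, gapLen]; ring
  · rw [P.atom_succ_of_ne_zero h, piece, if_neg h, gapRight_eq]
    congr 1
    simp [ends, len, gapLen, step]; ring

lemma piece_subset_Icc (e : Fin 2) : P.piece e ⊆ Icc (P.c - P.r) (P.c + P.r) := by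
  rw [← P.atom_one fun _ => e]
  exact P.atom_succ_subset _ 0

lemma code_mem_piece_iff {a : ℕ → Fin 2} {e : Fin 2} : P.code a ∈ P.piece e ↔ a 0 = e := by
  rw [← P.atom_one fun _ => e, code_mem_atom_iff]
  simp

lemma cantor_subset_piece : P.cantor ⊆ P.piece 0 ∪ P.piece 1 := by
  rw [← range_code]
  rintro _ ⟨a, rfl⟩
  rcases (by omega : a 0 = 0 ∨ a 0 = 1) with h | h
  exacts [.inl (P.code_mem_piece_iff.2 h), .inr (P.code_mem_piece_iff.2 h)]

/-- A point of the interval that lies in no gap lies in the Cantor set. -/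
lemma mem_cantor_of_notMem_gap {x : ℝ} (hx : x ∈ Icc (P.c - P.r) (P.c + P.r))
    (hg : ∀ a n, x ∉ P.gap a n) : x ∈ P.cantor := by
  have h : ∀ n, ∃ a, x ∈ P.atom a n := by
    intro n
    induction n with
    | zero => exact ⟨0, hx⟩
    | succ n ih =>
      obtain ⟨a, ha⟩ := ih
      -- Neither the atom nor the gap of generation `n` depends on entry `n`, so that entry is free
      -- to record the side of the gap on which `x` lies.
      have key : ∀ e, ∀ j < n, Function.update a n e j = a j := fun e j hj =>
        Function.update_of_ne hj.ne _ _
      rcases not_and_or.1 (hg a n) with h | h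
      · refine ⟨Function.update a n 0, ?_⟩
        rw [P.atom_succ_of_eq_zero (by simp), P.ends_congr (key 0), P.gapLeft_congr (key 0)]
        exact ⟨ha.1, not_lt.1 h⟩
      · refine ⟨Function.update a n 1, ?_⟩
        rw [P.atom_succ_of_ne_zero (by simp), P.ends_congr (key 1), P.gapRight_congr (key 1)]
        exact ⟨not_lt.1 h, ha.2⟩
  exact mem_iInter.2 fun n => mem_iUnion.2 (h _)

end CantorData

/-! ### Bowen maps act as the shift. -/

namespace IsBowenMap

variable {P : CantorData} {G : ℝ → ℝ}

/-- A Bowen map acts on the Cantor set as the shift. -/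
lemma map_code (hG : IsBowenMap P G) (a : ℕ → Fin 2) : G (P.code a) = P.code (shift a) := by
  -- Midpoints of the gaps along `a`: they tend to `code a`, while their images lie in the gaps
  -- along `shift a` and tend to `code (shift a)`.
  set y : ℕ → ℝ := fun n => (P.gapLeft a (n + 1) + P.gapRight a (n + 1)) / 2
  have hy : ∀ n, y n ∈ P.gap a (n + 1) := fun n =>
    have := P.gapLeft_lt_gapRight a (n + 1)
    ⟨by simp only [y]; linarith, by simp only [y]; linarith⟩
  have hsub : P.atom a 1 ⊆ P.piece 0 ∪ P.piece 1 := by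
    rw [P.atom_one]
    rcases (by omega : a 0 = 0 ∨ a 0 = 1) with h | h <;> rw [h]
    exacts [subset_union_left, subset_union_right]
  have hlim : Tendsto y atTop (𝓝 (P.code a)) :=
    tendsto_iff_dist_tendsto_zero.2 <| squeeze_zero (fun _ => dist_nonneg)
      (fun n => P.dist_code_le (P.gap_subset_atom _ _ (hy n)))
      ((tendsto_add_atTop_iff_nat 1).2 P.tendsto_len)
  have h1 : Tendsto (fun n => G (y n)) atTop (𝓝 (G (P.code a))) :=
    (hG.cont _ (hsub (P.code_mem_atom a 1))).tendsto.comp <|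
      tendsto_nhdsWithin_iff.2 ⟨hlim, .of_forall fun n =>
        hsub (P.atom_anti a (by omega) (P.gap_subset_atom _ _ (hy n)))⟩
  have h2 : Tendsto (fun n => G (y n)) atTop (𝓝 (P.code (shift a))) :=
    tendsto_iff_dist_tendsto_zero.2 <| squeeze_zero (fun _ => dist_nonneg)
      (fun n => P.dist_code_le (P.gap_subset_atom _ _ (hG.surj a n ▸ mem_image_of_mem G (hy n))))
      P.tendsto_len
  exact tendsto_nhds_unique h1 h2

lemma iterate_code (hG : IsBowenMap P G) (a : ℕ → Fin 2) (n : ℕ) :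
    G^[n] (P.code a) = P.code (shift^[n] a) := by
  have h : Function.Semiconj P.code shift G := fun a => (hG.map_code a).symm
  exact (h.iterate_right n a).symm

end IsBowenMap

lemma shift_iterate_apply {S : Type*} (a : ℕ → S) (n m : ℕ) : shift^[n] a m = a (m + n) := by
  induction n generalizing a with
  | zero => rfl
  | succ n ih => rw [Function.iterate_succ_apply, ih, shift, add_assoc]

lemma IsBowenMap.itin_code {P : CantorData} {G : ℝ → ℝ} (hG : IsBowenMap P G) (a : ℕ → Fin 2) :
    itin G (P.piece 1) (P.code a) = a := by
  funext n
  rw [itin, hG.iterate_code, P.code_mem_piece_iff, shift_iterate_apply, zero_add]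
  split_ifs <;> omega

/-! ### Bernoulli measures with equal weights. -/

section Bernoulli

lemma measurable_shift {S : Type*} [MeasurableSpace S] :
    Measurable (shift : (ℕ → S) → ℕ → S) :=
  measurable_pi_lambda _ fun _ => measurable_pi_apply _

lemma measurableSet_cylinder {S : Type*} [MeasurableSpace S] [DiscreteMeasurableSpace S]
    (w : ℕ → S) (n : ℕ) : MeasurableSet (PiNat.cylinder w n) := by
  rw [PiNat.cylinder_eq_pi]
  exact .pi (Finset.countable_toSet _) fun _ _ => .of_discrete

variable {S : Type*} [Fintype S] [Nonempty S] [MeasurableSpace S] [DiscreteMeasurableSpace S]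

variable (S) in
/-- The Bernoulli measure on one-sided sequences with equal weights. -/
def bernoulli : Measure (ℕ → S) :=
  Measure.infinitePi fun _ : ℕ => (PMF.uniformOfFintype S).toMeasure

instance : IsProbabilityMeasure (bernoulli S) := by
  unfold bernoulli; infer_instance

lemma bernoulli_cylinder (w : ℕ → S) (n : ℕ) :
    bernoulli S (PiNat.cylinder w n) = (Fintype.card S : ENNReal)⁻¹ ^ n := by
  rw [PiNat.cylinder_eq_pi, bernoulli, Measure.infinitePi_pi _ fun _ _ => .of_discrete]
  simp only [PMF.toMeasure_apply_singleton _ _ MeasurableSet.of_discrete,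
    PMF.uniformOfFintype_apply, Finset.prod_const, Finset.card_range]

/-- A probability measure giving all cylinders of the same length the same mass `|S| ^ (-n)` is the
Bernoulli measure. -/
lemma eq_bernoulli {ρ : Measure (ℕ → S)} [IsProbabilityMeasure ρ]
    (h : ∀ w n, ρ (PiNat.cylinder w n) = (Fintype.card S : ENNReal)⁻¹ ^ n) : ρ = bernoulli S := by
  -- With the discrete topology on `S` cylinders form a basis, so they generate the product
  -- σ-algebra; two that meet are nested, which gives a π-system.
  let _ : TopologicalSpace S := ⊥
  have _ : DiscreteTopology S := ⟨rfl⟩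
  refine ext_of_generate_finite _ ((BorelSpace.measurable_eq (α := ℕ → S)).trans
    (PiNat.isTopologicalBasis_cylinders fun _ : ℕ => S).borel_eq_generateFrom) ?_ ?_ (by simp)
  · rintro _ ⟨x, m, rfl⟩ _ ⟨y, n, rfl⟩ ⟨z, hzx, hzy⟩
    rw [PiNat.mem_cylinder_iff_eq] at hzx hzy
    rw [← hzx, ← hzy]
    rcases le_total m n with hmn | hmn
    · rw [inter_eq_right.2 (PiNat.cylinder_anti z hmn)]
      exact ⟨z, n, rfl⟩
    · rw [inter_eq_left.2 (PiNat.cylinder_anti z hmn)]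
      exact ⟨z, m, rfl⟩
  · rintro _ ⟨x, n, rfl⟩
    rw [h, bernoulli_cylinder]

/-- It suffices that cylinders of the same length have the same mass. -/
lemma eq_bernoulli_of_cylinder_eq {ρ : Measure (ℕ → S)} [IsProbabilityMeasure ρ]
    (h : ∀ w w' n, ρ (PiNat.cylinder w n) = ρ (PiNat.cylinder w' n)) : ρ = bernoulli S := by
  refine eq_bernoulli fun w n => ?_
  induction n with
  | zero => simp
  | succ n ih =>
    -- A cylinder of length `n` is the disjoint union of its `|S|` extensions, which have equal mass
    -- by hypothesis.
    have hd : Pairwise (Function.onFun Disjoint fun e =>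
        PiNat.cylinder (Function.update w n e) (n + 1)) := by
      intro e e' hee
      refine disjoint_left.2 fun x hx hx' => hee ?_
      have h1 := hx n n.lt_succ_self
      have h2 := hx' n n.lt_succ_self
      simpa using h1.symm.trans h2
    rw [← PiNat.iUnion_cylinder_update w n,
      measure_iUnion hd fun _ => measurableSet_cylinder _ _, tsum_fintype,
      Finset.sum_congr rfl fun e _ => h _ w (n + 1), Finset.sum_const, Finset.card_univ,
      nsmul_eq_mul] at ih
    rw [pow_succ', ← ih, ← mul_assoc, ENNReal.inv_mul_cancel (by simp) (by simp), one_mul]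

lemma measurePreserving_shift : MeasurePreserving shift (bernoulli S) (bernoulli S) := by
  have := Measure.isProbabilityMeasure_map (μ := bernoulli S) measurable_shift.aemeasurable
  refine ⟨measurable_shift, eq_bernoulli_of_cylinder_eq fun w w' n => ?_⟩
  have key : ∀ w : ℕ → S, bernoulli S (shift ⁻¹' PiNat.cylinder w n) =
      ∏ _j ∈ Finset.range n, (Fintype.card S : ENNReal)⁻¹ := by
    intro w
    -- The preimage constrains coordinates `1, …, n` instead of `0, …, n - 1`, so its mass does not
    -- depend on `w`.
    have : shift ⁻¹' PiNat.cylinder w n =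
        (((Finset.range n).image Nat.succ : Finset ℕ) : Set ℕ).pi fun j => {w (j - 1)} := by
      ext x
      simp [PiNat.cylinder, shift, Set.mem_pi]
    rw [this, bernoulli, Measure.infinitePi_pi _ fun _ _ => .of_discrete,
      Finset.prod_image fun _ _ _ _ h => Nat.succ_injective h]
    simp only [PMF.toMeasure_apply_singleton _ _ MeasurableSet.of_discrete,
      PMF.uniformOfFintype_apply]
  rw [Measure.map_apply measurable_shift (measurableSet_cylinder _ _),
    Measure.map_apply measurable_shift (measurableSet_cylinder _ _), key, key]

end Bernoulli

/-- Two binary sequences against one four-letter sequence. -/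
def pairEquiv : (ℕ → Fin 2) × (ℕ → Fin 2) ≃ᵐ (ℕ → Fin 4) where
  toFun p := pairSeq p.1 p.2
  invFun s := (fun n => ⟨(s n).val / 2, by omega⟩, fun n => ⟨(s n).val % 2, by omega⟩)
  left_inv p := by
    refine Prod.ext ?_ ?_ <;> funext n <;> simp only [pairSeq, pairSymbol, Fin.ext_iff] <;> omega
  right_inv s := by
    funext n; simp only [pairSeq, pairSymbol, Fin.ext_iff]; omega
  measurable_toFun := measurable_pi_lambda _ fun n =>
    (measurable_of_finite fun q : Fin 2 × Fin 2 => pairSymbol q.1 q.2).comp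
      (g := fun q : Fin 2 × Fin 2 => pairSymbol q.1 q.2)
      (f := fun p : (ℕ → Fin 2) × (ℕ → Fin 2) => (p.1 n, p.2 n))
      (((measurable_pi_apply n).comp measurable_fst).prodMk
        ((measurable_pi_apply n).comp measurable_snd))
  measurable_invFun := by
    refine (measurable_pi_lambda _ fun n => ?_).prodMk (measurable_pi_lambda _ fun n => ?_)
    · exact (measurable_of_finite fun e : Fin 4 => (⟨e.val / 2, by omega⟩ : Fin 2)).comp
        (measurable_pi_apply n)
    · exact (measurable_of_finite fun e : Fin 4 => (⟨e.val % 2, by omega⟩ : Fin 2)).comp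
        (measurable_pi_apply n)

lemma measurePreserving_pairEquiv :
    MeasurePreserving pairEquiv ((bernoulli (Fin 2)).prod (bernoulli (Fin 2))) bernoulliFour := by
  have := Measure.isProbabilityMeasure_map
    (μ := (bernoulli (Fin 2)).prod (bernoulli (Fin 2))) pairEquiv.measurable.aemeasurable
  -- `bernoulliFour` unfolds to `bernoulli (Fin 4)`. Equality of masses suffices: a four-letter
  -- cylinder pulls back to a product of two binary ones of the same length.
  refine ⟨pairEquiv.measurable, eq_bernoulli_of_cylinder_eq fun w w' n => ?_⟩
  have key : ∀ w : ℕ → Fin 4, pairEquiv ⁻¹' PiNat.cylinder w n =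
      PiNat.cylinder (pairEquiv.symm w).1 n ×ˢ PiNat.cylinder (pairEquiv.symm w).2 n := by
    intro w
    ext p
    simp only [mem_preimage, PiNat.cylinder, mem_prod, mem_ofPred_eq, ← forall₂_and]
    refine forall₂_congr fun j _ => ?_
    change pairSymbol (p.1 j) (p.2 j) = _ ↔
      p.1 j = ⟨(w j).val / 2, by omega⟩ ∧ p.2 j = ⟨(w j).val % 2, by omega⟩
    simp only [pairSymbol, Fin.ext_iff]
    omega
  rw [pairEquiv.map_apply, pairEquiv.map_apply, key, key, Measure.prod_prod, Measure.prod_prod]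
  simp only [bernoulli_cylinder]

/-! ### Lebesgue measure on the Cantor set. -/

namespace CantorData

variable (P : CantorData)

/-- Indexing by finite words, padded with `0`, counts each of the `2 ^ n` gaps of generation `n`
once. Generation `0` contributes `2 * b`, generation `n + 1` contributes `α (n + 1)`. -/
lemma iUnion_gap_volume_le :
    volume (⋃ n, ⋃ w : Fin n → Fin 2, P.gap (fun j => if h : j < n then w ⟨j, h⟩ else 0) n) ≤
      ENNReal.ofReal (2 * P.b + ∑' n, P.α (n + 1)) := by
  have h0 : ∀ n, 0 ≤ (2 : ℝ) ^ n * P.gapLen n := fun n => by have := P.gapLen_pos n; positivity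
  have h1 : ∀ n, (2 : ℝ) ^ (n + 1) * P.gapLen (n + 1) = P.α (n + 1) := fun n => by
    rw [gapLen]; field_simp
  have hs : Summable fun n => (2 : ℝ) ^ n * P.gapLen n :=
    (summable_nat_add_iff 1).1 (P.α_summable.congr fun n => (h1 n).symm)
  calc _ ≤ ∑' n, volume (⋃ w : Fin n → Fin 2,
          P.gap (fun j => if h : j < n then w ⟨j, h⟩ else 0) n) := measure_iUnion_le _
    _ ≤ ∑' n, ENNReal.ofReal (2 ^ n * P.gapLen n) := by
      refine ENNReal.tsum_le_tsum fun n => (measure_iUnion_fintype_le _ _).trans_eq ?_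
      have : ∀ a, volume (P.gap a n) = ENNReal.ofReal (P.gapLen n) := fun a => by
        rw [gap, Real.volume_Ioo, gapLeft, gapRight]; congr 1; ring
      simp only [this, Finset.sum_const, Finset.card_univ, Fintype.card_pi, Fintype.card_fin,
        Finset.prod_const, nsmul_eq_mul]
      rw [ENNReal.ofReal_mul (by positivity), ENNReal.ofReal_pow (by norm_num)]
      simp
    _ = _ := by
      rw [← ENNReal.ofReal_tsum_of_nonneg h0 hs, hs.tsum_eq_zero_add]
      simp only [h1]
      simp [gapLen]

/-- Otherwise gaps of total length less than `2 * r` would cover almost all of an interval of length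
`2 * r`. -/
lemma volume_cantor_pos : 0 < volume P.cantor := by
  by_contra! h0
  have hsub : Icc (P.c - P.r) (P.c + P.r) ⊆ P.cantor ∪
      ⋃ n, ⋃ w : Fin n → Fin 2, P.gap (fun j => if h : j < n then w ⟨j, h⟩ else 0) n := by
    intro x hx
    by_contra hn
    refine hn (.inl (P.mem_cantor_of_notMem_gap hx fun a n hg => hn (.inr ?_)))
    refine mem_iUnion₂.2 ⟨n, fun j => a j, ?_⟩
    have hj : ∀ j < n, a j = if h : j < n then a j else 0 := fun j hj => by simp [hj]
    rwa [gap, ← P.gapLeft_congr hj, ← P.gapRight_congr hj]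
  have h := (measure_mono (μ := volume) hsub).trans (measure_union_le _ _)
  rw [nonpos_iff_eq_zero.1 h0, zero_add, Real.volume_Icc] at h
  have h2 := (ENNReal.ofReal_le_ofReal_iff (add_nonneg (by linarith [P.b_pos])
    (tsum_nonneg fun n => (P.α_pos _ (by omega)).le))).1 (h.trans P.iUnion_gap_volume_le)
  linarith [P.α_sum]

lemma volume_cantor_ne_top : volume P.cantor ≠ ⊤ := by
  rw [← range_code]
  exact (isCompact_range P.continuous_code).measure_lt_top.ne

/-- Normalized Lebesgue measure on the Cantor set. -/
instance isProbabilityMeasure_cond_cantor : IsProbabilityMeasure (cond volume P.cantor) :=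
  cond_isProbabilityMeasure_of_finite P.volume_cantor_pos.ne' P.volume_cantor_ne_top

/-- Replacing the first `n` symbols translates the code by the difference of the left ends of the
atoms, since the tail of the series is unchanged. One inclusion is enough by symmetry. -/
lemma volume_image_cylinder (w w' : ℕ → Fin 2) (n : ℕ) :
    volume (P.code '' PiNat.cylinder w n) = volume (P.code '' PiNat.cylinder w' n) := by
  have key : ∀ w w' : ℕ → Fin 2, P.code '' PiNat.cylinder w n ⊆
      (fun x => ((P.ends w' n).1 - (P.ends w n).1) + x) ⁻¹' (P.code '' PiNat.cylinder w' n) := by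
    rintro w w' _ ⟨a, ha, rfl⟩
    refine ⟨fun j => if j < n then w' j else a j, fun j hj => by simp [hj], ?_⟩
    rw [P.code_eq a n, P.code_eq _ n, P.ends_congr ha,
      P.ends_congr (a := fun j => if j < n then w' j else a j) (a' := w')
        fun j hj => by simp [hj]]
    simp [← add_assoc]
  have hle : ∀ w w' : ℕ → Fin 2, volume (P.code '' PiNat.cylinder w n) ≤
      volume (P.code '' PiNat.cylinder w' n) := fun w w' =>
    (measure_mono (key w w')).trans_eq (measure_preimage_add _ _ _)
  exact le_antisymm (hle _ _) (hle _ _)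

/-- Coding carries the Bernoulli measure to normalized Lebesgue measure. -/
lemma measurePreserving_code :
    MeasurePreserving P.code (bernoulli (Fin 2)) (cond volume P.cantor) := by
  have he := P.isClosedEmbedding_code.measurableEmbedding
  -- Lebesgue measure is pulled back to sequences, where the cylinder criterion applies, and nothing
  -- is lost because it is carried by the range of `code`.
  have hm : ((cond volume P.cantor).comap P.code).map P.code = cond volume P.cantor := by
    rw [he.map_comap, range_code, Measure.restrict_eq_self_of_ae_mem]
    exact ae_cond_mem P.isClosed_cantor.measurableSet
  have hp : IsProbabilityMeasure ((cond volume P.cantor).comap P.code) := by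
    constructor
    rw [← preimage_univ (f := P.code), ← he.map_apply, hm, measure_univ]
  refine ⟨he.measurable, ?_⟩
  rw [← eq_bernoulli_of_cylinder_eq (ρ := (cond volume P.cantor).comap P.code), hm]
  intro w w' n
  have h : ∀ w : ℕ → Fin 2, P.cantor ∩ P.code '' PiNat.cylinder w n =
      P.code '' PiNat.cylinder w n := fun w =>
    inter_eq_right.2 (P.range_code ▸ image_subset_range _ _)
  rw [he.comap_apply, he.comap_apply, cond_apply P.isClosed_cantor.measurableSet,
    cond_apply P.isClosed_cantor.measurableSet, h, h, P.volume_image_cylinder w w']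

/-- Almost no sequence codes a point that ever visits a given countable set. -/
lemma ae_code_iterate_notMem {s : Set ℝ} (hs : s.Countable) :
    ∀ᵐ a ∂bernoulli (Fin 2), ∀ n, P.code (shift^[n] a) ∉ s := by
  refine ae_all_iff.2 fun n => ?_
  have h : ∀ᵐ x ∂cond volume P.cantor, x ∉ s :=
    cond_absolutelyContinuous.ae_le (hs.ae_notMem volume)
  exact (P.measurePreserving_code.comp
    (measurePreserving_shift.iterate n)).quasiMeasurePreserving.ae h

end CantorData

/-- A measure preserving embedding is a measure preserving equivalence onto its range. -/
lemma exists_measurableEquiv_range {X Y : Type*} [MeasurableSpace X] [MeasurableSpace Y] {g : X → Y}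
    {μ : Measure X} {ν : Measure Y} {s : Set Y} (hg : MeasurableEmbedding g)
    (hμ : MeasurePreserving g μ ν) (hs : range g = s) :
    ∃ e : X ≃ᵐ s, (∀ x, (e x : Y) = g x) ∧ MeasurePreserving e μ (ν.comap Subtype.val) := by
  subst hs
  have he : ∀ x, (hg.equivRange x : Y) = g x := fun x => by
    rw [hg.equivRange_apply]
  refine ⟨hg.equivRange, he, hg.equivRange.measurable, ?_⟩
  rw [← hμ.map_eq, ← (MeasurableEmbedding.subtype_coe hg.measurableSet_range).comap_map
    (μ.map hg.equivRange), Measure.map_map measurable_subtype_coe hg.equivRange.measurable,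
    show Subtype.val ∘ hg.equivRange = g from funext he]

/-! ### From the interval to the circle. -/

lemma eq_or_of_coe_eq {x y : ℝ} (hx : x ∈ Icc (-1 : ℝ) 1) (hy : y ∈ Icc (-1 : ℝ) 1)
    (h : (x : Circ) = y) : x = y ∨ (x = -1 ∧ y = 1) ∨ (x = 1 ∧ y = -1) := by
  obtain ⟨m, hm⟩ := AddSubgroup.mem_zmultiples_iff.1 ((QuotientAddGroup.eq_iff_sub_mem).1 h)
  rw [zsmul_eq_mul] at hm
  have h1 : m ≤ 1 := by
    have : (m : ℝ) ≤ (1 : ℤ) := by push_cast; linarith [hx.2, hy.1]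
    exact_mod_cast this
  have h2 : -1 ≤ m := by
    have : ((-1 : ℤ) : ℝ) ≤ m := by push_cast; linarith [hx.1, hy.2]
    exact_mod_cast this
  obtain rfl | rfl | rfl : m = -1 ∨ m = 0 ∨ m = 1 := by omega
  · exact .inr (.inl (by push_cast at hm; constructor <;> linarith [hx.1, hy.2]))
  · exact .inl (by push_cast at hm; linarith)
  · exact .inr (.inr (by push_cast at hm; constructor <;> linarith [hx.2, hy.1]))

lemma coe_neg_one : ((-1 : ℝ) : Circ) = ((1 : ℝ) : Circ) := by
  have h := AddCircle.coe_add_period (2 : ℝ) (-1)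
  norm_num at h
  simpa using h.symm

lemma coe_eq_coe_one_iff {x : ℝ} (hx : x ∈ Icc (-1 : ℝ) 1) :
    (x : Circ) = ((1 : ℝ) : Circ) ↔ x ∈ ({1, -1} : Set ℝ) := by
  constructor
  · intro h
    rcases eq_or_of_coe_eq hx (by norm_num) h with h | h | h
    exacts [.inl h, .inr h.1, .inl h.1]
  · rintro (rfl | rfl)
    exacts [rfl, coe_neg_one]

lemma coe_mem_image_iff {x : ℝ} {s : Set ℝ} (hs : s ⊆ Icc (-1 : ℝ) 1) (hx : x ∈ Icc (-1 : ℝ) 1)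
    (hx1 : x ∉ ({1, -1} : Set ℝ)) : (x : Circ) ∈ (fun x : ℝ => (x : Circ)) '' s ↔ x ∈ s := by
  refine ⟨?_, fun h => mem_image_of_mem _ h⟩
  rintro ⟨y, hy, h⟩
  rcases eq_or_of_coe_eq hx (hs hy) h.symm with rfl | h | h
  exacts [hy, (hx1 (.inr h.1)).elim, (hx1 (.inl h.1)).elim]

lemma isClosed_coe_image {s : Set ℝ} (hs : IsCompact s) :
    IsClosed ((fun x : ℝ => (x : Circ)) '' s) :=
  (hs.image (AddCircle.continuous_mk' 2)).isClosed

/-- Normalized Lebesgue measure on a compact subset of `[-1, 1]` passes to the circle. -/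
lemma map_coe_cond {s : Set ℝ} (hc : IsCompact s) (hs : s ⊆ Icc (-1 : ℝ) 1) :
    (cond volume s).map (fun x : ℝ => (x : Circ)) =
      cond volume ((fun x : ℝ => (x : Circ)) '' s) := by
  have hq := AddCircle.measurePreserving_mk 2 (-1)
  have hm := (isClosed_coe_image hc).measurableSet
  -- On the fundamental domain `(-1, 1]` the saturation of `s` can differ from `s` only at the glued
  -- endpoints, a null set.
  have hae : ((fun x : ℝ => (x : Circ)) ⁻¹' ((fun x : ℝ => (x : Circ)) '' s) ∩
      Ioc (-1 : ℝ) (-1 + 2) : Set ℝ) =ᵐ[volume] s := by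
    filter_upwards [(countable_insert.2 (countable_singleton (-1 : ℝ)) :
      ({1, -1} : Set ℝ).Countable).ae_notMem volume] with x hx
    refine propext ⟨fun h => ?_, fun h => ⟨mem_image_of_mem _ h, ?_⟩⟩
    · exact (coe_mem_image_iff hs ⟨h.2.1.le, by linarith [h.2.2]⟩ hx).1 h.1
    · have := hs h
      exact ⟨lt_of_le_of_ne this.1 fun h => hx (.inr h.symm), by linarith [this.2]⟩
  have hr : volume.restrict ((fun x : ℝ => (x : Circ)) '' s) =
      (volume.restrict s).map (fun x : ℝ => (x : Circ)) := by
    rw [← hq.map_eq, Measure.restrict_map hq.measurable hm,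
      Measure.restrict_restrict (hq.measurable hm), Measure.restrict_congr_set hae]
  have hv : volume ((fun x : ℝ => (x : Circ)) '' s) = volume s := by
    rw [← Measure.restrict_apply_self, hr, Measure.map_apply hq.measurable hm]
    exact Measure.restrict_apply_superset (subset_preimage_image _ _)
  rw [ProbabilityTheory.cond, ProbabilityTheory.cond, hr, hv, Measure.map_smul]

/-! ### Dynamics and measure on the Cantor sets of a circle map. -/

namespace BowenCircleMap

variable {k : ℕ} [NeZero k] (Φ : BowenCircleMap k) (i : Fin k)

/-- Strong induction along hosts: a host gap lies in the interval of a set with a smaller number,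
and set `0` fills `[-1, 1]`. -/
lemma Icc_subset : Icc ((Φ.P i).c - (Φ.P i).r) ((Φ.P i).c + (Φ.P i).r) ⊆ Icc (-1 : ℝ) 1 := by
  induction i using WellFoundedLT.induction with
  | ind i ih =>
    by_cases h : i = 0
    · rw [h, Φ.center_zero, Φ.radius_zero]; norm_num
    · exact (Φ.sub_host i h).trans <| ((Φ.P _).gap_subset_atom _ _).trans <|
        ((Φ.P _).atom_anti _ (Nat.zero_le _)).trans (ih _ (Φ.host_lt i h))

lemma piece_subset (e : Fin 2) : (Φ.P i).piece e ⊆ Icc (-1 : ℝ) 1 :=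
  ((Φ.P i).piece_subset_Icc e).trans (Φ.Icc_subset i)

lemma code_mem (a : ℕ → Fin 2) : (Φ.P i).code a ∈ Icc (-1 : ℝ) 1 :=
  Φ.Icc_subset i ((Φ.P i).code_mem_atom a 0)

lemma cantor_subset : (Φ.P i).cantor ⊆ Icc (-1 : ℝ) 1 := by
  rw [← CantorData.range_code]
  rintro _ ⟨a, rfl⟩
  exact Φ.code_mem i a

lemma isCompact_cantor : IsCompact (Φ.P i).cantor :=
  isCompact_Icc.of_isClosed_subset (Φ.P i).isClosed_cantor (Φ.cantor_subset i)

/-- The point of the Cantor set in the circle with a given itinerary. -/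
def code (a : ℕ → Fin 2) : Circ := ((Φ.P i).code a : Circ)

lemma continuous_code : Continuous (Φ.code i) :=
  (AddCircle.continuous_mk' 2).comp (Φ.P i).continuous_code

lemma range_code : range (Φ.code i) = Φ.K i := by
  rw [K, CantorData.cantorCirc, ← CantorData.range_code, ← range_comp]
  rfl

lemma isClosed_K : IsClosed (Φ.K i) := isClosed_coe_image (Φ.isCompact_cantor i)

lemma isClosed_pieceCirc (e : Fin 2) : IsClosed (Φ.pieceCirc i e) := by
  refine isClosed_coe_image ?_
  rw [CantorData.piece]
  split_ifs <;> exact isCompact_Icc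

lemma continuous_f : Continuous Φ.f := by
  refine (QuotientAddGroup.isQuotientMap_mk
    (N := AddSubgroup.zmultiples (2 : ℝ))).continuous_iff.2 ?_
  rw [show Φ.f ∘ QuotientAddGroup.mk = QuotientAddGroup.mk ∘ Φ.F from funext Φ.lift]
  exact (AddCircle.continuous_mk' 2).comp Φ.smooth.continuous

/-- The exception made in `agree` for host gaps is void here, because codes lie in no gap. -/
lemma f_coe {x : ℝ} (hx : x ∈ (Φ.P i).cantor) : Φ.f (x : Circ) = (Φ.G i x : Circ) := by
  refine Φ.agree i x ((Φ.P i).cantor_subset_piece hx) fun j _ _ => ?_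
  rw [← CantorData.range_code] at hx
  obtain ⟨a, rfl⟩ := hx
  exact (Φ.P i).code_notMem_gap _ _ _

lemma f_code (a : ℕ → Fin 2) : Φ.f (Φ.code i a) = Φ.code i (shift a) := by
  rw [code, Φ.f_coe i ((Φ.P i).range_code ▸ mem_range_self a), (Φ.bowen i).map_code, code]

lemma iterate_f_code (a : ℕ → Fin 2) (n : ℕ) :
    Φ.f^[n] (Φ.code i a) = Φ.code i (shift^[n] a) := by
  have h : Function.Semiconj (Φ.code i) shift Φ.f := fun a => (Φ.f_code i a).symm
  exact (h.iterate_right n a).symm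

lemma mapsTo_K : MapsTo Φ.f (Φ.K i) (Φ.K i) := by
  rw [← range_code]
  rintro _ ⟨a, rfl⟩
  exact ⟨_, (Φ.f_code i a).symm⟩

lemma code_eq_coe_one_iff (a : ℕ → Fin 2) :
    Φ.code i a = ((1 : ℝ) : Circ) ↔ (Φ.P i).code a ∈ ({1, -1} : Set ℝ) :=
  coe_eq_coe_one_iff (Φ.code_mem i a)

/-- The sequences whose point on the circle never visits `-1 ∼ 1` under the dynamics. -/
def regular : Set (ℕ → Fin 2) := {a | ∀ n, Φ.code i (shift^[n] a) ≠ ((1 : ℝ) : Circ)}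

lemma ae_mem_regular : ∀ᵐ a ∂bernoulli (Fin 2), a ∈ Φ.regular i := by
  filter_upwards [(Φ.P i).ae_code_iterate_notMem
    (countable_insert.2 (countable_singleton (-1 : ℝ)) : ({1, -1} : Set ℝ).Countable)] with a ha n
  exact fun h => ha n ((Φ.code_eq_coe_one_iff i _).1 h)

/-- Away from the glued point, lying in an atom means the same on the circle as on the line. At that
point the circle could assign symbol `1` to a code `-1` whose symbol is `0`, hence the regularity
assumption. -/
lemma itin_code {a : ℕ → Fin 2} (ha : a ∈ Φ.regular i) :
    itin Φ.f (Φ.pieceCirc i 1) (Φ.code i a) = a := by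
  funext n
  have h : Φ.code i (shift^[n] a) ∈ Φ.pieceCirc i 1 ↔ a n = 1 := by
    rw [pieceCirc, code, coe_mem_image_iff (Φ.piece_subset i 1) (Φ.code_mem i _)
      fun h => ha n ((Φ.code_eq_coe_one_iff i _).2 h), (Φ.P i).code_mem_piece_iff,
      shift_iterate_apply, zero_add]
  rw [itin, Φ.iterate_f_code, h]
  split_ifs <;> omega

lemma measurable_itin : Measurable (itin Φ.f (Φ.pieceCirc i 1)) := by
  classical
  refine measurable_pi_lambda _ fun n => ?_
  have : MeasurableSet {x | Φ.f^[n] x ∈ Φ.pieceCirc i 1} :=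
    (Φ.continuous_f.iterate n).measurable (Φ.isClosed_pieceCirc i 1).measurableSet
  exact Measurable.ite this measurable_const measurable_const

lemma iterate_mem_pieceCirc {x : Circ} (hx : x ∈ Φ.K i) (n : ℕ) :
    Φ.f^[n] x ∈ Φ.pieceCirc i (itin Φ.f (Φ.pieceCirc i 1) x n) := by
  rw [itin]
  split_ifs with h
  · exact h
  -- The orbit stays in the Cantor set, which two atoms cover, so leaving atom `1` forces atom `0`,
  -- regular orbit or not.
  · obtain ⟨y, hy, hyx⟩ := (Φ.mapsTo_K i).iterate n hx
    rw [← hyx] at h ⊢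
    rcases (Φ.P i).cantor_subset_piece hy with hy | hy
    exacts [mem_image_of_mem _ hy, (h (mem_image_of_mem _ hy)).elim]

/-- Coding carries the Bernoulli measure to normalized Lebesgue measure on the circle. -/
lemma measurePreserving_code : MeasurePreserving (Φ.code i) (bernoulli (Fin 2)) (Φ.μ i) := by
  have h : MeasurePreserving (fun x : ℝ => (x : Circ)) (cond volume (Φ.P i).cantor) (Φ.μ i) :=
    ⟨(AddCircle.continuous_mk' 2).measurable,
      map_coe_cond (Φ.isCompact_cantor i) (Φ.cantor_subset i)⟩
  exact h.comp (Φ.P i).measurePreserving_code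

instance isProbabilityMeasure_μ : IsProbabilityMeasure (Φ.μ i) := by
  rw [← (Φ.measurePreserving_code i).map_eq]
  exact Measure.isProbabilityMeasure_map (Φ.continuous_code i).measurable.aemeasurable

lemma measurePreserving_f : MeasurePreserving Φ.f (Φ.μ i) (Φ.μ i) := by
  refine ⟨Φ.continuous_f.measurable, ?_⟩
  have h : Φ.f ∘ Φ.code i = Φ.code i ∘ shift := funext (Φ.f_code i)
  conv_lhs => rw [← (Φ.measurePreserving_code i).map_eq]
  rw [Measure.map_map Φ.continuous_f.measurable (Φ.continuous_code i).measurable, h,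
    ((Φ.measurePreserving_code i).comp measurePreserving_shift).map_eq]

lemma mapsTo_cantor : MapsTo (Φ.G i) (Φ.P i).cantor (Φ.P i).cantor := by
  rw [← CantorData.range_code]
  rintro _ ⟨a, rfl⟩
  exact ⟨_, ((Φ.bowen i).map_code a).symm⟩

lemma iterate_mem_piece {x : ℝ} (hx : x ∈ (Φ.P i).cantor) (n : ℕ) :
    (Φ.G i)^[n] x ∈ (Φ.P i).piece (itin (Φ.G i) ((Φ.P i).piece 1) x n) := by
  rw [← CantorData.range_code] at hx
  obtain ⟨a, rfl⟩ := hx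
  rw [(Φ.bowen i).itin_code, (Φ.bowen i).iterate_code, (Φ.P i).code_mem_piece_iff,
    shift_iterate_apply, zero_add]

end BowenCircleMap

end BowenTorus

end

/-! ### The product system on the square and on the torus. -/

theorem mainTheorem8 (k : ℕ) [NeZero k] (Φ : BowenTorus.BowenCircleMap 1)
    (Ψ : BowenTorus.BowenCircleMap k) (i : Fin k) :
    let f : BowenTorus.Circ × BowenTorus.Circ → BowenTorus.Circ × BowenTorus.Circ :=
      BowenTorus.torusMap Φ.f Ψ.f
    let KT : Set (BowenTorus.Circ × BowenTorus.Circ) := Φ.K 0 ×ˢ Ψ.K i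
    let μ : Measure (BowenTorus.Circ × BowenTorus.Circ) := (Φ.μ 0).prod (Ψ.μ i)
    let a : BowenTorus.Circ → ℕ → Fin 2 := BowenTorus.itin Φ.f (Φ.pieceCirc 0 1)
    let b : BowenTorus.Circ → ℕ → Fin 2 := BowenTorus.itin Ψ.f (Ψ.pieceCirc i 1)
    let h : BowenTorus.Circ × BowenTorus.Circ → ℕ → Fin 4 :=
      fun p => BowenTorus.pairSeq (a p.1) (b p.2)
    let E : Set (BowenTorus.Circ × BowenTorus.Circ) :=
      {p ∈ KT | ∀ n : ℕ, (f^[n] p).1 ≠ ((1 : ℝ) : BowenTorus.Circ) ∧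
        (f^[n] p).2 ≠ ((1 : ℝ) : BowenTorus.Circ)}
    let KI : Set (ℝ × ℝ) := (Φ.P 0).cantor ×ˢ (Ψ.P i).cantor
    let μI : Measure (ℝ × ℝ) :=
      (ProbabilityTheory.cond volume (Φ.P 0).cantor).prod
        (ProbabilityTheory.cond volume (Ψ.P i).cantor)
    let G : ℝ × ℝ → ℝ × ℝ := fun p => (Φ.G 0 p.1, Ψ.G i p.2)
    let aI : ℝ → ℕ → Fin 2 := BowenTorus.itin (Φ.G 0) ((Φ.P 0).piece 1)
    let bI : ℝ → ℕ → Fin 2 := BowenTorus.itin (Ψ.G i) ((Ψ.P i).piece 1)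
    let hI : ℝ × ℝ → ℕ → Fin 4 := fun p => BowenTorus.pairSeq (aI p.1) (bI p.2)
    -- `μ` is an `f`-invariant probability measure carried by `KT`
    (IsProbabilityMeasure μ ∧ μ KTᶜ = 0 ∧ MeasurePreserving f μ μ) ∧
    -- in the square, the combined itinerary is an everywhere defined bimeasurable conjugation
    ((∀ p ∈ KI, G p ∈ KI ∧
        f ((p.1 : BowenTorus.Circ), (p.2 : BowenTorus.Circ)) =
          (((G p).1 : BowenTorus.Circ), ((G p).2 : BowenTorus.Circ))) ∧
      (∀ p ∈ KI, ∀ n : ℕ, (Φ.G 0)^[n] p.1 ∈ (Φ.P 0).piece (aI p.1 n) ∧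
        (Ψ.G i)^[n] p.2 ∈ (Ψ.P i).piece (bI p.2 n)) ∧
      (∀ p ∈ KI, hI (G p) = BowenTorus.shift (hI p)) ∧
      ∃ H : KI ≃ᵐ (ℕ → Fin 4), (∀ p : KI, H p = hI p) ∧
        MeasurePreserving H (μI.comap Subtype.val) BowenTorus.bernoulliFour) ∧
    -- on the torus, it is a bimeasurable conjugation on the set `E` of full measure
    ((∀ p ∈ KT, ∀ n : ℕ, Φ.f^[n] p.1 ∈ Φ.pieceCirc 0 (a p.1 n) ∧
        Ψ.f^[n] p.2 ∈ Ψ.pieceCirc i (b p.2 n)) ∧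
      (∀ p ∈ KT, h (f p) = BowenTorus.shift (h p)) ∧
      MeasurePreserving h μ BowenTorus.bernoulliFour ∧
      MeasurableSet E ∧ μ Eᶜ = 0 ∧ MapsTo f E E ∧ InjOn h E ∧
      (∀ B ⊆ E, MeasurableSet B → MeasurableSet (h '' B)) ∧
      BowenTorus.bernoulliFour (h '' E)ᶜ = 0) := by
  intro f KT μ a b h E KI μI G aI bI hI
  -- the coding maps of the torus and of the square
  let C : (ℕ → Fin 2) × (ℕ → Fin 2) → BowenTorus.Circ × BowenTorus.Circ :=
    Prod.map (Φ.code 0) (Ψ.code i)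
  let β : Measure (ℕ → Fin 2) := BowenTorus.bernoulli (Fin 2)
  have hC : MeasurePreserving C (β.prod β) μ :=
    (Φ.measurePreserving_code 0).prod (Ψ.measurePreserving_code i)
  have hCI : MeasurePreserving (Prod.map (Φ.P 0).code (Ψ.P i).code) (β.prod β) μI :=
    (Φ.P 0).measurePreserving_code.prod (Ψ.P i).measurePreserving_code
  have hKT : range C = KT := by rw [range_prodMap, Φ.range_code, Ψ.range_code]
  have hKTm : MeasurableSet KT :=
    (Φ.isClosed_K 0).measurableSet.prod (Ψ.isClosed_K i).measurableSet
  have hfm : Measurable f := (Φ.continuous_f.prodMap Ψ.continuous_f).measurable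
  have hiter : ∀ n p, f^[n] p = (Φ.f^[n] p.1, Ψ.f^[n] p.2) := fun n p =>
    congrFun (Prod.map_iterate Φ.f Ψ.f n) p
  have hmapsKT : MapsTo f KT KT := fun p hp => ⟨Φ.mapsTo_K 0 hp.1, Ψ.mapsTo_K i hp.2⟩
  -- the regular pairs of sequences code the points of `E`
  have hCE : ∀ s, C s ∈ E ↔ s.1 ∈ Φ.regular 0 ∧ s.2 ∈ Ψ.regular i := by
    intro s
    have h0 : C s ∈ KT := hKT ▸ mem_range_self s
    simp only [E, h0, true_and, hiter, BowenTorus.BowenCircleMap.regular,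
      mem_ofPred_eq, ← forall_and]
    refine forall_congr' fun n => ?_
    simp only [C, Prod.map_apply', Φ.iterate_f_code, Ψ.iterate_f_code]
  have hhC : ∀ s, C s ∈ E → h (C s) = BowenTorus.pairEquiv s := by
    intro s hs
    obtain ⟨h1, h2⟩ := (hCE s).1 hs
    change BowenTorus.pairSeq (a (Φ.code 0 s.1)) (b (Ψ.code i s.2)) = _
    rw [show a (Φ.code 0 s.1) = s.1 from Φ.itin_code 0 h1,
      show b (Ψ.code i s.2) = s.2 from Ψ.itin_code i h2]
    rfl
  have hreg : ∀ᵐ s ∂β.prod β, C s ∈ E := by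
    have h1 := Measure.quasiMeasurePreserving_fst (μ := β) (ν := β) |>.ae (Φ.ae_mem_regular 0)
    have h2 := Measure.quasiMeasurePreserving_snd (μ := β) (ν := β) |>.ae (Ψ.ae_mem_regular i)
    filter_upwards [h1, h2] with s hs1 hs2 using (hCE s).2 ⟨hs1, hs2⟩
  have hhm : Measurable h := BowenTorus.pairEquiv.measurable.comp <|
    ((Φ.measurable_itin 0).comp measurable_fst).prodMk ((Ψ.measurable_itin i).comp measurable_snd)
  have hE : MeasurableSet E := by
    have : E = KT ∩ ⋂ n, f^[n] ⁻¹' ({((1 : ℝ) : BowenTorus.Circ)}ᶜ ×ˢ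
        {((1 : ℝ) : BowenTorus.Circ)}ᶜ) := by
      ext p; simp [E]
    rw [this]
    exact hKTm.inter <| .iInter fun n => hfm.iterate n <|
      (measurableSet_singleton _).compl.prod (measurableSet_singleton _).compl
  have hEnull : μ Eᶜ = 0 := by
    rw [← hC.measure_preimage hE.compl.nullMeasurableSet]
    exact hreg
  have hhμ : MeasurePreserving h μ BowenTorus.bernoulliFour := by
    refine ⟨hhm, ?_⟩
    rw [← hC.map_eq, Measure.map_map hhm hC.measurable,
      ← BowenTorus.measurePreserving_pairEquiv.map_eq]
    refine Measure.map_congr ?_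
    filter_upwards [hreg] with s hs using hhC s hs
  -- On `E` the map `h` inverts the coding, so an image under `h` is a preimage under the measurable
  -- map `C ∘ pairEquiv.symm`; this makes it Borel.
  have himage : ∀ B ⊆ E, h '' B = BowenTorus.pairEquiv.symm ⁻¹' (C ⁻¹' B) := by
    intro B hB
    ext t
    constructor
    · rintro ⟨p, hp, rfl⟩
      obtain ⟨s, rfl⟩ : p ∈ range C := hKT ▸ (hB hp).1
      rw [hhC s (hB hp), mem_preimage, MeasurableEquiv.symm_apply_apply]
      exact hp
    · intro ht
      exact ⟨_, ht, (hhC _ (hB ht)).trans (MeasurableEquiv.apply_symm_apply _ _)⟩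
  have himagem : ∀ B ⊆ E, MeasurableSet B → MeasurableSet (h '' B) := fun B hB hm =>
    himage B hB ▸ BowenTorus.pairEquiv.symm.measurable (hC.measurable hm)
  refine ⟨⟨?_, ?_, ?_⟩, ⟨?_, ?_, ?_, ?_⟩, ?_, ?_, hhμ, hE, hEnull, ?_, ?_, himagem, ?_⟩
  · exact inferInstanceAs (IsProbabilityMeasure ((Φ.μ 0).prod (Ψ.μ i)))
  · exact measure_mono_null (compl_subset_compl.2 fun p hp => hp.1) hEnull
  · exact (Φ.measurePreserving_f 0).prod (Ψ.measurePreserving_f i)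
  · intro p hp
    exact ⟨⟨Φ.mapsTo_cantor 0 hp.1, Ψ.mapsTo_cantor i hp.2⟩,
      Prod.ext (Φ.f_coe 0 hp.1) (Ψ.f_coe i hp.2)⟩
  · exact fun p hp n => ⟨Φ.iterate_mem_piece 0 hp.1 n, Ψ.iterate_mem_piece i hp.2 n⟩
  -- Holds by definition: `g^[n + 1] x` unfolds to `g^[n] (g x)`, for points of the Cantor set or
  -- not.
  · exact fun p _ => rfl
  · have hemb : MeasurableEmbedding (Prod.map (Φ.P 0).code (Ψ.P i).code) :=
      ((Φ.P 0).isClosedEmbedding_code.prodMap (Ψ.P i).isClosedEmbedding_code).measurableEmbedding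
    have hKI : range (Prod.map (Φ.P 0).code (Ψ.P i).code) = KI := by
      rw [range_prodMap, (Φ.P 0).range_code, (Ψ.P i).range_code]
    -- In the square the coding is injective everywhere, so its inverse followed by `pairEquiv` is
    -- the required equivalence with no exceptional set.
    obtain ⟨e, he, heμ⟩ := BowenTorus.exists_measurableEquiv_range hemb hCI hKI
    refine ⟨e.symm.trans BowenTorus.pairEquiv, fun p => ?_,
      BowenTorus.measurePreserving_pairEquiv.comp (heμ.symm e)⟩
    obtain ⟨s, rfl⟩ := e.surjective p
    have h1 : aI (e s : ℝ × ℝ).1 = s.1 := by rw [he]; exact (Φ.bowen 0).itin_code s.1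
    have h2 : bI (e s : ℝ × ℝ).2 = s.2 := by rw [he]; exact (Ψ.bowen i).itin_code s.2
    change BowenTorus.pairEquiv (e.symm (e s)) = BowenTorus.pairSeq _ _
    rw [h1, h2, e.symm_apply_apply]
    rfl
  · exact fun p hp n => ⟨Φ.iterate_mem_pieceCirc 0 hp.1 n, Ψ.iterate_mem_pieceCirc i hp.2 n⟩
  · exact fun p _ => rfl
  · exact fun p hp => ⟨hmapsKT hp.1, fun n => hp.2 (n + 1)⟩
  · intro p hp q hq hpq
    obtain ⟨s, rfl⟩ : p ∈ range C := hKT ▸ hp.1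
    obtain ⟨t, rfl⟩ : q ∈ range C := hKT ▸ hq.1
    rw [hhC s hp, hhC t hq] at hpq
    rw [BowenTorus.pairEquiv.injective hpq]
  -- The preimage under `h` of the complement of `h '' E` misses `E`, hence is null.
  · rw [← hhμ.measure_preimage (himagem E subset_rfl hE).compl.nullMeasurableSet]
    exact measure_mono_null (fun p hp hpE => hp (mem_image_of_mem h hpE)) hEnull
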